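/- \textbf{Setting.} Let $M$ be a Markov decision process with finite state space $\mathcal S$, finite action space $\mathcal A$, transition probabilities $P(s,a,\cdot)$ and reward function $R:\mathcal S\times\mathcal A\times\mathcal S\to\mathbb R$. Let $\gamma\in(0,1)$ and let $$Q^*(s,a)=\sup_\pi \mathbb E\Big[\sum_{i\ge 0}\gamma^i r_i \,\Big|\, s_0=s,\ a_0=a,\ \pi\Big],$$ the supremum being over all (history-dependent, randomized) policies. Let $k,c,d\in\mathbb R$ with $c\neq 0$, and $$f(x)=c\ln(x+\gamma^k)+d,\qquad f^{-1}(x)=e^{(x-d)/c}-\gamma^k .$$ \textbf{Experience.} On a probability space with filtration $(\mathcal F_t)_{t\ge0}$ let $s_t,a_t$ be $\mathcal F_t$-measurable, and let the observed next state $s'_t$ be $\mathcal F_{t+1}$-measurable with $\Pr(s'_t=x\mid\mathcal F_t)=P(s_t,a_t,x)$ for every $x\in\mathcal S$. (For a single trajectory $s'_t=s_{t+1}$; restarts of episodes are allowed. Actions may be selected in any way based on $\mathcal F_t$.) Put $r_t=R(s_t,a_t,s'_t)$, $r^+_t=\max(r_t,0)$ and $r_t^-=\max(-r_t,0)$. \textbf{Algorithm.}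 Let $\widetilde Q^\pm_0:\mathcal S\times\mathcal A\to\mathbb R$ be arbitrary, and let the step-sizes $\beta_{log,t}\in[0,1]$ and $\beta_{reg,t}\in\mathbb R$ be $\mathcal F_t$-measurable. Logarithmic Q-learning is $$Q_t(s,a)=f^{-1}(\widetilde Q_t^+(s,a))-f^{-1}(\widetilde Q_t^-(s,a)),\qquad \tilde a_{t+1}\in\arg\max_{a'}Q_t(s'_t,a'),$$ $$U^\pm_t=r_t^\pm+\gamma f^{-1}\big(\widetilde Q_t^\pm(s'_t,\tilde a_{t+1})\big),\qquad \hat U_t^\pm=f^{-1}\big(\widetilde Q_t^\pm(s_t,a_t)\big)+\beta_{reg,t}\Big(U_t^\pm-f^{-1}\big(\widetilde Q_t^\pm(s_t,a_t)\big)\Big),$$ $$\widetilde Q^\pm_{t+1}(s_t,a_t)=\widetilde Q^\pm_t(s_t,a_t)+\beta_{log,t}\Big(f(\hat U^\pm_t)-\widetilde Q^\pm_t(s_t,a_t)\Big),$$ all other entries of $\widetilde Q^\pm$ being left unchanged; ties in the $\arg\max$ are broken in any $\mathcal F_{t+1}$-measurable way. (If $0\le\beta_{reg,t}\le1$, the arguments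 of the logarithms are positive. Should $\hat U_t^\pm+\gamma^k\le 0$ occur otherwise, read $\ln x$ as $\ln|x|$ and $\ln 0$ as $0$.) \textbf{Theorem.} Suppose that with probability 1: \begin{enumerate} \item $0\le\beta_{log,t}\,\beta_{reg,t}\le1$ for all $t$; \item $\sum_{t:\,(s_t,a_t)=(s,a)}\beta_{log,t}\,\beta_{reg,t}=\infty$ for every $(s,a)\in\mathcal S\times\mathcal A$ (in particular every state-action pair is visited infinitely often); \item $\sum_{t=0}^\infty(\beta_{log,t}\,\beta_{reg,t})^2<\infty$; \item $\lim_{t\to\infty}\beta_{reg,t}=0$. \end{enumerate} Then, with probability 1, $\lim_{t\to\infty}Q_t(s,a)=Q^*(s,a)$ for all $(s,a)\in\mathcal S\times\mathcal A$. -/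

import Mathlib

open MeasureTheory ProbabilityTheory Filter Topology

/-- A Markov decision process with state space `S` and action space `A`: `P s a` is the law of the
next state and `R s a s'` the reward of a transition. (No start distribution is recorded: the
initial state may have any law.) -/
structure MDP (S A : Type*) where
  P : S → A → PMF S
  R : S → A → S → ℝ

/-- A history-dependent randomized policy: from the past state-action pairs (most recent first) and
the current state it produces a distribution over actions. Past rewards are functions of the past
states and actions, so they need not be listed. -/
abbrev Policy (S A : Type*) := List (S × A) → S → PMF A

namespace MDP

variable {S A : Type*}

/-- The joint law at time `n` of (past state-action pairs, current state, current action), when the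
process starts in `s` with action `a` and follows `π` afterwards. -/
noncomputable def histLaw (M : MDP S A) (π : Policy S A) (s : S) (a : A) :
    ℕ → PMF (List (S × A) × (S × A))
  | 0 => PMF.pure ([], (s, a))
  | n + 1 => (M.histLaw π s a n).bind fun h =>
      (M.P h.2.1 h.2.2).bind fun s' =>
        (π (h.2 :: h.1) s').map fun a' => (h.2 :: h.1, (s', a'))

/-- `𝔼[r_n]`, the expected reward at time `n`, starting with `(s, a)` and following `π`. -/
noncomputable def expReward [Fintype S] [Fintype A] (M : MDP S A) (π : Policy S A) (s : S) (a : A)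
    (n : ℕ) : ℝ :=
  ∑ p : S × A, (((M.histLaw π s a n).map Prod.snd) p).toReal *
    ∑ s' : S, (M.P p.1 p.2 s').toReal * M.R p.1 p.2 s'

/-- The expected discounted sum of rewards, starting with `(s, a)` and following `π`. -/
noncomputable def qValue [Fintype S] [Fintype A] (M : MDP S A) (γ : ℝ) (π : Policy S A)
    (s : S) (a : A) : ℝ :=
  ∑' n : ℕ, γ ^ n * M.expReward π s a n

/-- The optimal action-value function `Q*`. -/
noncomputable def qStar [Fintype S] [Fintype A] (M : MDP S A) (γ : ℝ) (s : S) (a : A) : ℝ :=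
  ⨆ π : Policy S A, M.qValue γ π s a

/-- A stream of experience from `M`: at time `t` the agent is in state `s t`, selects `a t` on the
basis of the information `𝓕 t`, and observes the next state `s' t`, whose conditional law given
`𝓕 t` is `P (s t) (a t)`. A single trajectory is the case `s' t = s (t + 1)`; experience that is cut
into episodes, with restarts, is also covered. -/
structure IsExperience [MeasurableSpace S] [MeasurableSpace A] (M : MDP S A)
    {Ω : Type*} {mΩ : MeasurableSpace Ω} (μ : Measure Ω) (𝓕 : Filtration ℕ mΩ)
    (s : ℕ → Ω → S) (a : ℕ → Ω → A) (s' : ℕ → Ω → S) : Prop where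
  measurable_state : ∀ t, Measurable[𝓕 t] (s t)
  measurable_action : ∀ t, Measurable[𝓕 t] (a t)
  measurable_next : ∀ t, Measurable[𝓕 (t + 1)] (s' t)
  transition : ∀ t x,
    μ[(s' t ⁻¹' {x}).indicator (fun _ => (1 : ℝ)) | 𝓕 t]
      =ᵐ[μ] fun ω => (M.P (s t ω) (a t ω) x).toReal

end MDP

namespace LogQ

/-- The mapping function `f(x) = c ln(x + γ^k) + d`. -/
noncomputable def f (γ k c d x : ℝ) : ℝ := c * Real.log (x + γ ^ k) + d

/-- Its inverse `f⁻¹(x) = e^((x - d)/c) - γ^k`. -/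
noncomputable def fInv (γ k c d x : ℝ) : ℝ := Real.exp ((x - d) / c) - γ ^ k

/-- The positive component of a reward. -/
noncomputable def rPlus (r : ℝ) : ℝ := if 0 ≤ r then r else 0

/-- The negative component of a reward. -/
noncomputable def rMinus (r : ℝ) : ℝ := if r < 0 then |r| else 0

variable {S A : Type*}

/-- The value function represented by the two log-space tables: `f⁻¹(Q̃⁺) - f⁻¹(Q̃⁻)`. -/
noncomputable def combine (γ k c d : ℝ) (Qt : (S → A → ℝ) × (S → A → ℝ)) (s : S) (a : A) : ℝ :=
  fInv γ k c d (Qt.1 s a) - fInv γ k c d (Qt.2 s a)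

/-- One update of a single log-space table `T` at the pair `(s, a)`, for the reward component `r`,
the next state `s'` and the action `b` at `s'`:
`U = r + γ f⁻¹(T(s', b))`, `Û = f⁻¹(T(s, a)) + β_reg (U - f⁻¹(T(s, a)))`, and
`T(s, a)` becomes `T(s, a) + β_log (f(Û) - T(s, a))`. -/
noncomputable def step [DecidableEq S] [DecidableEq A] (γ k c d βlog βreg : ℝ) (s : S) (a : A)
    (r : ℝ) (s' : S) (b : A) (T : S → A → ℝ) : S → A → ℝ :=
  let U := r + γ * fInv γ k c d (T s' b)
  let Uhat := fInv γ k c d (T s a) + βreg * (U - fInv γ k c d (T s a))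
  fun x y => if x = s ∧ y = a then T s a + βlog * (f γ k c d Uhat - T s a) else T x y

/-- The pair of tables `(Q̃⁺_t, Q̃⁻_t)` of logarithmic Q-learning along one stream of experience:
`s t`, `a t`, `s' t` are the state, action and next state at time `t`, the reward is
`R (s t) (a t) (s' t)`, and `b t` is the action used at `s' t` in the update targets. -/
noncomputable def tables [DecidableEq S] [DecidableEq A] (M : MDP S A) (γ k c d : ℝ)
    (T₀ : (S → A → ℝ) × (S → A → ℝ)) (βlog βreg : ℕ → ℝ)
    (s : ℕ → S) (a : ℕ → A) (s' : ℕ → S) (b : ℕ → A) : ℕ → (S → A → ℝ) × (S → A → ℝ)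
  | 0 => T₀
  | t + 1 =>
    let T := tables M γ k c d T₀ βlog βreg s a s' b t
    let r := M.R (s t) (a t) (s' t)
    (step γ k c d (βlog t) (βreg t) (s t) (a t) (rPlus r) (s' t) (b t) T.1,
     step γ k c d (βlog t) (βreg t) (s t) (a t) (rMinus r) (s' t) (b t) T.2)

/-- `Q_t = f⁻¹(Q̃⁺_t) - f⁻¹(Q̃⁻_t)`. -/
noncomputable def Q [DecidableEq S] [DecidableEq A] (M : MDP S A) (γ k c d : ℝ)
    (T₀ : (S → A → ℝ) × (S → A → ℝ)) (βlog βreg : ℕ → ℝ)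
    (s : ℕ → S) (a : ℕ → A) (s' : ℕ → S) (b : ℕ → A) (t : ℕ) : S → A → ℝ :=
  combine γ k c d (tables M γ k c d T₀ βlog βreg s a s' b t)

end LogQ

/-!
Put `κ = γ ^ k` and `X = f⁻¹(T)` for a table `T`. In terms of `Y = X + κ > 0` the parameters `c` and
`d` drop out: an update replaces `Y` by the weighted geometric mean `Y ^ (1 - β_log) * V ^ β_log`,
where `V = Y + β_reg (U - X)` is itself a weighted arithmetic mean of `Y` and `U + κ` as soon as
`β_reg ≤ 1`. Hence, from some time on that depends on the path, every update stays between
constants `0 < m ≤ κ` and `B ≥ κ + max |R| / (1 - γ)` that hold at that time (`LogQ.exists_bounds`).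
On such a range the geometric mean can be linearised: the new value of `X` is
`X + β_log β_reg (U - X)` up to a relative error of order `β_reg`, which tends to zero
(`LogQ.exists_step_error_le`). Subtracting the two tables shows that `Q_t` follows ordinary
asynchronous Q-learning with step sizes `α_t = β_log β_reg`, bounded iterates and vanishing relative
errors (`LogQ.exists_Q_step_error_le`).

The convergence of such a scheme has three ingredients.

* `Q*` is the fixed point of the Bellman operator, a `γ`-contraction in the sup norm. A fixed point
  exists by Banach's theorem; telescoping the equation along the process shows that no
  history-dependent policy exceeds it and that a greedy policy attains it (`MDP.bellman_qStar`).
* The deviation of a sampled target from its conditional mean is a combination of the bounded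
  martingale differences `1[s' = z] - P(s, a, z)` with predictable coefficients. The coefficients,
  multiplied by `α_t`, are square-summable along almost every path, which is enough for the weighted
  noise to have a convergent sum (`StochApprox.ae_exists_tendsto_sum`). No uniform bound on the
  iterates over the probability space is available, nor needed.
* Along a fixed path, noise whose weighted sum converges averages out to zero because `∑ α_t = ∞`
  (`StochApprox.exists_averagedNoise`). With the averaged noise removed, an eventual bound `D` for
  the error improves to every bound larger than `γ D`, so the error tends to zero
  (`StochApprox.tendsto_zero_of_contraction`, `LogQ.tendsto_Q_of_noise`).
-/

/-! ### Deterministic averaging recursions -/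

namespace StochApprox

/-- A sequence that is repeatedly averaged with a number `e`, with weights of infinite sum, ends up
below every number larger than `e`: the excess over `e` decays like `exp (-∑ α)`. -/
lemma eventually_le_of_averaging {α z : ℕ → ℝ} {e e' : ℝ} (h1 : ∀ t, α t ≤ 1)
    (hsum : Tendsto (fun n => ∑ t ∈ Finset.range n, α t) atTop atTop)
    (hz : ∀ᶠ t in atTop, z (t + 1) ≤ (1 - α t) * z t + α t * e) (he : e < e') :
    ∀ᶠ t in atTop, z t ≤ e' := by
  obtain ⟨N, hN⟩ := eventually_atTop.1 hz
  set C := max (z N - e) 0 * Real.exp (∑ t ∈ Finset.range N, α t) with hC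
  have key : ∀ n, N ≤ n → z n - e ≤ C * Real.exp (-∑ t ∈ Finset.range n, α t) := by
    intro n hn
    induction n, hn using Nat.le_induction with
    | base =>
      rw [hC, mul_assoc, ← Real.exp_add]
      simp
    | succ n hn ih =>
      have hC0 : 0 ≤ C * Real.exp (-∑ t ∈ Finset.range n, α t) := by positivity
      have hexp : 1 - α n ≤ Real.exp (-α n) := by
        have := Real.add_one_le_exp (-α n)
        linarith
      calc z (n + 1) - e ≤ (1 - α n) * (z n - e) := by linarith [hN n hn]
        _ ≤ (1 - α n) * (C * Real.exp (-∑ t ∈ Finset.range n, α t)) :=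
          mul_le_mul_of_nonneg_left ih (by linarith [h1 n])
        _ ≤ Real.exp (-α n) * (C * Real.exp (-∑ t ∈ Finset.range n, α t)) :=
          mul_le_mul_of_nonneg_right hexp hC0
        _ = C * Real.exp (-∑ t ∈ Finset.range (n + 1), α t) := by
          rw [Finset.sum_range_succ, neg_add, Real.exp_add]
          ring
  have hlim : Tendsto (fun n => C * Real.exp (-∑ t ∈ Finset.range n, α t)) atTop (𝓝 0) := by
    simpa using (Real.tendsto_exp_neg_atTop_nhds_zero.comp hsum).const_mul C
  filter_upwards [hlim.eventually_lt_const (sub_pos.2 he), eventually_ge_atTop N] with n hn hNn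
  linarith [key n hNn]

lemma tendsto_zero_of_averaging {α z ε : ℕ → ℝ} (h0 : ∀ t, 0 ≤ α t) (h1 : ∀ t, α t ≤ 1)
    (hsum : Tendsto (fun n => ∑ t ∈ Finset.range n, α t) atTop atTop)
    (hε : Tendsto ε atTop (𝓝 0)) (hz : ∀ t, z (t + 1) = (1 - α t) * z t + α t * ε t) :
    Tendsto z atTop (𝓝 0) := by
  refine Metric.tendsto_atTop'.2 fun δ hδ => ?_
  have hev : ∀ᶠ t in atTop, |z (t + 1)| ≤ (1 - α t) * |z t| + α t * (δ / 3) := by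
    filter_upwards [hε.abs.eventually_le_const (u := δ / 3) (by simpa using by positivity)]
      with t ht
    rw [hz]
    refine (abs_add_le _ _).trans ?_
    rw [abs_mul, abs_mul, abs_of_nonneg (h0 t), abs_of_nonneg (sub_nonneg.2 (h1 t))]
    gcongr
    exact h0 t
  obtain ⟨N, hN⟩ := eventually_atTop.1
    (eventually_le_of_averaging (z := fun t => |z t|) h1 hsum hev (e' := δ / 2) (by linarith))
  refine ⟨N, fun n hn => ?_⟩
  simpa using (hN n hn.le).trans_lt (by linarith)

/-- If the weighted noises `α t * w t` have a convergent sum, then the running average of the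
noises, taken with the weights `α`, tends to zero. -/
lemma exists_averagedNoise {α w : ℕ → ℝ} {l : ℝ} (h0 : ∀ t, 0 ≤ α t) (h1 : ∀ t, α t ≤ 1)
    (hsum : Tendsto (fun n => ∑ t ∈ Finset.range n, α t) atTop atTop)
    (hw : Tendsto (fun n => ∑ t ∈ Finset.range n, α t * w t) atTop (𝓝 l)) :
    ∃ W : ℕ → ℝ, Tendsto W atTop (𝓝 0) ∧
      ∀ t, W (t + 1) = (1 - α t) * W t + α t * w t := by
  let W : ℕ → ℝ := fun n => Nat.rec 0 (fun t W => (1 - α t) * W + α t * w t) n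
  have hW : ∀ t, W (t + 1) = (1 - α t) * W t + α t * w t := fun t => rfl
  refine ⟨W, ?_, hW⟩
  -- Subtracting the tail of the convergent series turns the noise into a null sequence.
  set r : ℕ → ℝ := fun n => l - ∑ t ∈ Finset.range n, α t * w t with hr
  have hr0 : Tendsto r atTop (𝓝 0) := by simpa using hw.const_sub l
  have hz : Tendsto (fun n => W n + r n) atTop (𝓝 0) := by
    refine tendsto_zero_of_averaging h0 h1 hsum hr0 fun t => ?_
    simp only [hW, hr, Finset.sum_range_succ]
    ring
  simpa using hz.sub hr0

/-- Asynchronous stochastic approximation of the fixed point of a sup-norm contraction, in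
deterministic form: if every coordinate of a bounded sequence is averaged with a quantity at most
`γ` times the sup norm, up to a null sequence, then the sequence tends to zero. -/
lemma tendsto_zero_of_contraction {ι : Type*} [Fintype ι] {γ : ℝ} (hγ0 : 0 < γ) (hγ1 : γ < 1)
    {α : ι → ℕ → ℝ} (h0 : ∀ i t, 0 ≤ α i t) (h1 : ∀ i t, α i t ≤ 1)
    (hsum : ∀ i, Tendsto (fun n => ∑ t ∈ Finset.range n, α i t) atTop atTop)
    {Δ : ℕ → ι → ℝ} {B : ℝ} (hB : ∀ t, ‖Δ t‖ ≤ B) {η : ℕ → ℝ} (hη : Tendsto η atTop (𝓝 0))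
    (hΔ : ∀ᶠ t in atTop, ∀ i,
      |Δ (t + 1) i| ≤ (1 - α i t) * |Δ t i| + α i t * (γ * ‖Δ t‖ + η t)) :
    Tendsto Δ atTop (𝓝 0) := by
  set D := B + 1 with hD
  have hD0 : 0 < D := by linarith [(norm_nonneg _).trans (hB 0)]
  set ρ := (1 + γ) / 2 with hρ
  have hρ0 : 0 < ρ := by linarith
  have key : ∀ n : ℕ, ∀ᶠ t in atTop, ‖Δ t‖ ≤ ρ ^ n * D := by
    intro n
    induction n with
    | zero => exact Eventually.of_forall fun t => by simpa [hD] using (hB t).trans (by linarith)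
    | succ n ih =>
      have hDn : 0 < ρ ^ n * D := by positivity
      have hgap : 0 < (ρ - γ) / 2 * (ρ ^ n * D) := mul_pos (by linarith) hDn
      have hi : ∀ i, ∀ᶠ t in atTop, |Δ t i| ≤ ρ ^ (n + 1) * D := by
        intro i
        refine eventually_le_of_averaging (h1 i) (hsum i)
          (e := γ * (ρ ^ n * D) + (ρ - γ) / 2 * (ρ ^ n * D)) ?_ ?_
        · filter_upwards [hΔ, ih, hη.eventually_le_const hgap] with t ht hn hη'
          refine (ht i).trans ?_
          gcongr
          exact h0 i t
        · rw [pow_succ]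
          nlinarith
      filter_upwards [eventually_all.2 hi] with t ht
      exact (pi_norm_le_iff_of_nonneg (by positivity)).2 ht
  rw [tendsto_zero_iff_norm_tendsto_zero]
  refine Metric.tendsto_atTop'.2 fun δ hδ => ?_
  have hpow : Tendsto (fun n : ℕ => ρ ^ n * D) atTop (𝓝 0) := by
    simpa using (tendsto_pow_atTop_nhds_zero_of_lt_one hρ0.le (by linarith)).mul_const D
  obtain ⟨n, hn⟩ := (hpow.eventually_lt_const hδ).exists
  obtain ⟨N, hN⟩ := eventually_atTop.1 (key n)
  exact ⟨N, fun t ht => by simpa using (hN t ht.le).trans_lt hn⟩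

end StochApprox

/-! ### Expectations under finite laws -/

namespace PMF

variable {X Y : Type*} [Fintype X] [Fintype Y]

lemma sum_toReal_eq_one (p : PMF X) : ∑ x, (p x).toReal = 1 := by
  rw [← ENNReal.toReal_sum fun x _ => p.apply_ne_top x, ← tsum_fintype (L := .unconditional X),
    p.tsum_coe, ENNReal.toReal_one]

lemma sum_bind_toReal_mul (p : PMF X) (q : X → PMF Y) (g : Y → ℝ) :
    ∑ y, ((p.bind q) y).toReal * g y = ∑ x, (p x).toReal * ∑ y, (q x y).toReal * g y := by
  have h : ∀ y, ((p.bind q) y).toReal = ∑ x, (p x).toReal * (q x y).toReal := by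
    intro y
    rw [PMF.bind_apply, tsum_fintype, ENNReal.toReal_sum
      fun x _ => ENNReal.mul_ne_top (p.apply_ne_top x) ((q x).apply_ne_top y)]
    simp
  simp only [h, Finset.sum_mul, Finset.mul_sum]
  rw [Finset.sum_comm]
  simp only [mul_assoc]

lemma sum_map_toReal_mul (p : PMF X) (f : X → Y) (g : Y → ℝ) :
    ∑ y, ((p.map f) y).toReal * g y = ∑ x, (p x).toReal * g (f x) := by
  classical
  rw [← PMF.bind_pure_comp, sum_bind_toReal_mul]
  refine Finset.sum_congr rfl fun x _ => ?_
  rw [Finset.sum_eq_single (f x)]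
  · simp
  · intro y _ hy
    simp [PMF.pure_apply, hy]
  · simp

lemma abs_sum_toReal_mul_le (p : PMF X) {g : X → ℝ} {B : ℝ} (hg : ∀ x, |g x| ≤ B) :
    |∑ x, (p x).toReal * g x| ≤ B := by
  calc |∑ x, (p x).toReal * g x| ≤ ∑ x, |(p x).toReal * g x| := Finset.abs_sum_le_sum_abs _ _
    _ ≤ ∑ x, (p x).toReal * B := by
        refine Finset.sum_le_sum fun x _ => ?_
        rw [abs_mul, abs_of_nonneg ENNReal.toReal_nonneg]
        exact mul_le_mul_of_nonneg_left (hg x) ENNReal.toReal_nonneg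
    _ = B := by rw [← Finset.sum_mul, p.sum_toReal_eq_one, one_mul]

end PMF

/-! ### The Bellman optimality equation -/

lemma abs_ciSup_sub_ciSup_le {X : Type*} [Finite X] [Nonempty X] {f g : X → ℝ} {D : ℝ}
    (h : ∀ x, |f x - g x| ≤ D) : |(⨆ x, f x) - ⨆ x, g x| ≤ D := by
  have hf := (Set.finite_range f).bddAbove
  have hg := (Set.finite_range g).bddAbove
  rw [abs_sub_le_iff]
  constructor
  · rw [sub_le_iff_le_add]
    exact ciSup_le fun x => by linarith [(abs_sub_le_iff.1 (h x)).1, le_ciSup hg x]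
  · rw [sub_le_iff_le_add]
    exact ciSup_le fun x => by linarith [(abs_sub_le_iff.1 (h x)).2, le_ciSup hf x]

namespace MDP

variable {S A : Type*}

/-- The Bellman optimality operator on action-value functions. -/
noncomputable def bellman [Fintype S] (M : MDP S A) (γ : ℝ) (q : S × A → ℝ) (p : S × A) : ℝ :=
  ∑ z, (M.P p.1 p.2 z).toReal * (M.R p.1 p.2 z + γ * ⨆ y, q (z, y))

lemma abs_bellman_sub_le [Fintype S] [Fintype A] [Nonempty A] (M : MDP S A) {γ : ℝ} (hγ : 0 ≤ γ)
    (q q' : S × A → ℝ) (p : S × A) :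
    |M.bellman γ q p - M.bellman γ q' p| ≤ γ * ‖q - q'‖ := by
  have h : M.bellman γ q p - M.bellman γ q' p =
      ∑ z, (M.P p.1 p.2 z).toReal * (γ * ((⨆ y, q (z, y)) - ⨆ y, q' (z, y))) := by
    simp only [bellman]
    rw [← Finset.sum_sub_distrib]
    exact Finset.sum_congr rfl fun z _ => by ring
  rw [h]
  refine PMF.abs_sum_toReal_mul_le _ fun z => ?_
  rw [abs_mul, abs_of_nonneg hγ]
  refine mul_le_mul_of_nonneg_left (abs_ciSup_sub_ciSup_le fun y => ?_) hγ
  exact norm_le_pi_norm (q - q') (z, y)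

lemma exists_bellman_fixedPoint [Fintype S] [Fintype A] [Nonempty A] (M : MDP S A) {γ : ℝ}
    (hγ0 : 0 ≤ γ) (hγ1 : γ < 1) : ∃ q : S × A → ℝ, M.bellman γ q = q := by
  have hc : ContractingWith ⟨γ, hγ0⟩ (M.bellman γ) := by
    refine ⟨hγ1, LipschitzWith.of_dist_le_mul fun q q' => ?_⟩
    rw [dist_eq_norm, dist_eq_norm]
    exact (pi_norm_le_iff_of_nonneg (mul_nonneg hγ0 (norm_nonneg _))).2 fun p =>
      M.abs_bellman_sub_le hγ0 q q' p
  exact ⟨_, hc.fixedPoint_isFixedPt⟩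

/-- The law of the state-action pair at time `n`. -/
noncomputable def pairLaw (M : MDP S A) (π : Policy S A) (s : S) (a : A) (n : ℕ) : PMF (S × A) :=
  (M.histLaw π s a n).map Prod.snd

/-- The law of the next state depends on the policy only through the current state-action pair. -/
lemma pairLaw_succ_map_fst (M : MDP S A) (π : Policy S A) (s : S) (a : A) (n : ℕ) :
    (M.pairLaw π s a (n + 1)).map Prod.fst =
      (M.pairLaw π s a n).bind fun p => M.P p.1 p.2 := by
  simp only [pairLaw, histLaw, PMF.map_bind, PMF.map_comp, PMF.bind_map]
  congr 1
  funext h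
  exact (congrArg _ (funext fun z => PMF.map_const _ z)).trans (PMF.bind_pure _)

lemma sum_pairLaw_succ_fst [Fintype S] [Fintype A] (M : MDP S A) (π : Policy S A) (s : S) (a : A)
    (n : ℕ) (v : S → ℝ) :
    ∑ p, (M.pairLaw π s a (n + 1) p).toReal * v p.1 =
      ∑ p, (M.pairLaw π s a n p).toReal * ∑ z, (M.P p.1 p.2 z).toReal * v z := by
  rw [← PMF.sum_bind_toReal_mul, ← pairLaw_succ_map_fst, PMF.sum_map_toReal_mul]

/-- One step of the Bellman operator along the process: the reward now plus the discounted best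
value at the next state, whatever the policy does there. -/
lemma sum_pairLaw_bellman [Fintype S] [Fintype A] (M : MDP S A) (γ : ℝ) (π : Policy S A)
    (s : S) (a : A) (n : ℕ) (q : S × A → ℝ) :
    ∑ p, (M.pairLaw π s a n p).toReal * M.bellman γ q p =
      M.expReward π s a n +
        γ * ∑ p, (M.pairLaw π s a (n + 1) p).toReal * ⨆ y, q (p.1, y) := by
  rw [M.sum_pairLaw_succ_fst π s a n fun z => ⨆ y, q (z, y)]
  simp only [expReward, bellman, pairLaw, mul_add, Finset.sum_add_distrib, Finset.mul_sum]
  congr 1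
  exact Finset.sum_congr rfl fun p _ => Finset.sum_congr rfl fun z _ => by ring

lemma exists_abs_reward_le [Finite S] [Finite A] (M : MDP S A) :
    ∃ B, ∀ x y z, |M.R x y z| ≤ B := by
  obtain ⟨B, hB⟩ := (Set.finite_range fun p : S × A × S => |M.R p.1 p.2.1 p.2.2|).bddAbove
  exact ⟨B, fun x y z => hB ⟨(x, y, z), rfl⟩⟩

lemma exists_abs_expReward_le [Fintype S] [Fintype A] (M : MDP S A) :
    ∃ B, ∀ π s a n, |M.expReward π s a n| ≤ B := by
  obtain ⟨B, hB⟩ := M.exists_abs_reward_le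
  exact ⟨B, fun π s a n => PMF.abs_sum_toReal_mul_le _ fun p =>
    PMF.abs_sum_toReal_mul_le _ fun z => hB _ _ _⟩

/-- The series defining `qValue` converges, so that its value is not the default `0` of `tsum`. -/
lemma hasSum_qValue [Fintype S] [Fintype A] (M : MDP S A) {γ : ℝ} (hγ0 : 0 ≤ γ) (hγ1 : γ < 1)
    (π : Policy S A) (s : S) (a : A) :
    HasSum (fun n => γ ^ n * M.expReward π s a n) (M.qValue γ π s a) := by
  obtain ⟨B, hB⟩ := M.exists_abs_expReward_le
  refine (Summable.of_norm_bounded ((summable_geometric_of_lt_one hγ0 hγ1).mul_right B)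
    fun n => ?_).hasSum
  rw [norm_mul, norm_pow, Real.norm_of_nonneg hγ0, Real.norm_eq_abs]
  exact mul_le_mul_of_nonneg_left (hB π s a n) (by positivity)

lemma tendsto_pow_mul_sum_pairLaw [Fintype S] [Fintype A] (M : MDP S A) {γ : ℝ} (hγ0 : 0 ≤ γ)
    (hγ1 : γ < 1) (π : Policy S A) (s : S) (a : A) (q : S × A → ℝ) :
    Tendsto (fun n => γ ^ n * ∑ p, (M.pairLaw π s a n p).toReal * q p) atTop (𝓝 0) := by
  have h := (tendsto_pow_atTop_nhds_zero_of_lt_one hγ0 hγ1).mul_const ‖q‖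
  rw [zero_mul] at h
  refine squeeze_zero_norm (fun n => ?_) h
  rw [norm_mul, norm_pow, Real.norm_of_nonneg hγ0]
  exact mul_le_mul_of_nonneg_left
    (PMF.abs_sum_toReal_mul_le _ fun p => norm_le_pi_norm q p) (by positivity)

lemma sum_pairLaw_zero [Fintype S] [Fintype A] (M : MDP S A) (π : Policy S A) (s : S) (a : A)
    (q : S × A → ℝ) : ∑ p, (M.pairLaw π s a 0 p).toReal * q p = q (s, a) := by
  classical
  rw [Finset.sum_eq_single (s, a)]
  · simp [pairLaw, histLaw, PMF.pure_map]
  · intro p _ hp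
    simp [pairLaw, histLaw, PMF.pure_map, PMF.pure_apply, hp]
  · simp

/-- No policy does better than a fixed point of the Bellman operator: telescope the equation
along the process. -/
lemma qValue_le_of_bellman_eq [Fintype S] [Fintype A] [Nonempty A] (M : MDP S A) {γ : ℝ}
    (hγ0 : 0 ≤ γ) (hγ1 : γ < 1) {q : S × A → ℝ} (hq : M.bellman γ q = q) (π : Policy S A)
    (s : S) (a : A) : M.qValue γ π s a ≤ q (s, a) := by
  have key : ∀ n, ∑ i ∈ Finset.range n, γ ^ i * M.expReward π s a i +
      γ ^ n * ∑ p, (M.pairLaw π s a n p).toReal * q p ≤ q (s, a) := by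
    intro n
    induction n with
    | zero => simp [sum_pairLaw_zero]
    | succ n ih =>
      refine le_trans ?_ ih
      have h1 := M.sum_pairLaw_bellman γ π s a n q
      rw [hq] at h1
      have h2 : ∑ p, (M.pairLaw π s a (n + 1) p).toReal * q p ≤
          ∑ p, (M.pairLaw π s a (n + 1) p).toReal * ⨆ y, q (p.1, y) :=
        Finset.sum_le_sum fun p _ => mul_le_mul_of_nonneg_left
          (le_ciSup (f := fun y => q (p.1, y)) (Set.finite_range _).bddAbove p.2)
          ENNReal.toReal_nonneg
      rw [h1, Finset.sum_range_succ, pow_succ]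
      have := mul_le_mul_of_nonneg_left h2 (mul_nonneg (pow_nonneg hγ0 n) hγ0)
      linarith
  have h := (M.hasSum_qValue hγ0 hγ1 π s a).tendsto_sum_nat.add
    (M.tendsto_pow_mul_sum_pairLaw hγ0 hγ1 π s a q)
  rw [add_zero] at h
  exact le_of_tendsto' h key

/-- A policy that is greedy for a fixed point of the Bellman operator attains it. -/
lemma exists_qValue_eq_of_bellman_eq [Fintype S] [Fintype A] [Nonempty A] (M : MDP S A) {γ : ℝ}
    (hγ0 : 0 ≤ γ) (hγ1 : γ < 1) {q : S × A → ℝ} (hq : M.bellman γ q = q) (s : S) (a : A) :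
    ∃ π : Policy S A, M.qValue γ π s a = q (s, a) := by
  choose σ hσ using fun z : S => exists_eq_ciSup_of_finite (f := fun y : A => q (z, y))
  refine ⟨fun _ z => PMF.pure (σ z), ?_⟩
  set π : Policy S A := fun _ z => PMF.pure (σ z) with hπ
  have hsupp : ∀ n p, M.pairLaw π s a (n + 1) p ≠ 0 → p.2 = σ p.1 := by
    intro n p hp
    rw [← PMF.mem_support_iff] at hp
    simp only [pairLaw, histLaw, hπ, PMF.pure_map, PMF.support_map, PMF.support_bind,
      PMF.support_pure, Set.mem_image, Set.mem_iUnion, Set.mem_singleton_iff] at hp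
    obtain ⟨h, ⟨_, _, z, _, rfl⟩, rfl⟩ := hp
    rfl
  have key : ∀ n, ∑ i ∈ Finset.range n, γ ^ i * M.expReward π s a i +
      γ ^ n * ∑ p, (M.pairLaw π s a n p).toReal * q p = q (s, a) := by
    intro n
    induction n with
    | zero => simp [sum_pairLaw_zero]
    | succ n ih =>
      rw [← ih]
      have h1 := M.sum_pairLaw_bellman γ π s a n q
      rw [hq] at h1
      have h2 : ∑ p, (M.pairLaw π s a (n + 1) p).toReal * q p =
          ∑ p, (M.pairLaw π s a (n + 1) p).toReal * ⨆ y, q (p.1, y) := by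
        refine Finset.sum_congr rfl fun p _ => ?_
        by_cases hp : M.pairLaw π s a (n + 1) p = 0
        · simp [hp]
        · rw [← hσ p.1, ← hsupp n p hp]
      rw [h1, h2, Finset.sum_range_succ, pow_succ]
      ring
  have h := (M.hasSum_qValue hγ0 hγ1 π s a).tendsto_sum_nat.add
    (M.tendsto_pow_mul_sum_pairLaw hγ0 hγ1 π s a q)
  rw [add_zero] at h
  exact tendsto_nhds_unique h (by simp [key])

/-- The Bellman optimality equation, for the supremum over history-dependent randomized
policies. -/
theorem bellman_qStar [Fintype S] [Fintype A] [Nonempty A] (M : MDP S A) {γ : ℝ}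
    (hγ0 : 0 ≤ γ) (hγ1 : γ < 1) :
    M.bellman γ (fun p => M.qStar γ p.1 p.2) = fun p => M.qStar γ p.1 p.2 := by
  obtain ⟨q, hq⟩ := M.exists_bellman_fixedPoint hγ0 hγ1
  have h : (fun p : S × A => M.qStar γ p.1 p.2) = q := by
    funext p
    obtain ⟨π, hπ⟩ := M.exists_qValue_eq_of_bellman_eq hγ0 hγ1 hq p.1 p.2
    have : Nonempty (Policy S A) := ⟨π⟩
    refine le_antisymm (ciSup_le fun π' => M.qValue_le_of_bellman_eq hγ0 hγ1 hq π' p.1 p.2) ?_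
    rw [← Prod.mk.eta (p := p), ← hπ]
    exact le_ciSup (f := fun π' => M.qValue γ π' p.1 p.2)
      ⟨q p, by rintro _ ⟨π', rfl⟩; exact M.qValue_le_of_bellman_eq hγ0 hγ1 hq π' p.1 p.2⟩ π
  rw [h, hq]

end MDP

/-! ### Convergence of the noise -/

namespace StochApprox

variable {Ω : Type*} {mΩ : MeasurableSpace Ω} {μ : Measure Ω} [IsProbabilityMeasure μ]
  {𝓕 : Filtration ℕ mΩ} {u ξ : ℕ → Ω → ℝ}

/-- With square sums of the weights bounded by a constant, the weighted sums of the noise form an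
`L²`-bounded martingale. -/
lemma ae_exists_tendsto_sum_of_sq_le {K : ℝ} (hK : 0 ≤ K) (hu : ∀ t, Measurable[𝓕 t] (u t))
    (hξ : ∀ t, Measurable[𝓕 (t + 1)] (ξ t)) (hξ1 : ∀ t ω, |ξ t ω| ≤ 1)
    (hξ0 : ∀ t, μ[ξ t | 𝓕 t] =ᵐ[μ] 0)
    (huK : ∀ n ω, ∑ t ∈ Finset.range n, u t ω ^ 2 ≤ K) :
    ∀ᵐ ω ∂μ, ∃ l, Tendsto (fun n => ∑ t ∈ Finset.range n, u t ω * ξ t ω) atTop (𝓝 l) := by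
  set Z : ℕ → Ω → ℝ := fun n ω => ∑ t ∈ Finset.range n, u t ω * ξ t ω with hZ
  have hZm : ∀ n, Measurable[𝓕 n] (Z n) := by
    intro n
    refine Finset.measurable_sum _ fun t ht => ?_
    have htn : t + 1 ≤ n := Finset.mem_range.1 ht
    exact ((hu t).mono (𝓕.mono (by omega)) le_rfl).mul ((hξ t).mono (𝓕.mono htn) le_rfl)
  have hub : ∀ t ω, |u t ω| ≤ K + 1 := by
    intro t ω
    have h1 : u t ω ^ 2 ≤ K := (Finset.single_le_sum (f := fun t => u t ω ^ 2)
      (fun i _ => sq_nonneg _) (Finset.self_mem_range_succ t)).trans (huK (t + 1) ω)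
    exact abs_le_of_sq_le_sq (by nlinarith) (by linarith)
  have huξ : ∀ t ω, |u t ω * ξ t ω| ≤ K + 1 := by
    intro t ω
    rw [abs_mul]
    exact (mul_le_of_le_one_right (abs_nonneg _) (hξ1 t ω)).trans (hub t ω)
  have hZb : ∀ n ω, |Z n ω| ≤ n * (K + 1) := by
    intro n ω
    refine (Finset.abs_sum_le_sum_abs _ _).trans ?_
    exact (Finset.sum_le_card_nsmul (Finset.range n) _ _ fun t _ => huξ t ω).trans_eq (by simp; ring)
  have hint : ∀ {g : Ω → ℝ}, Measurable g → ∀ C : ℝ, (∀ ω, |g ω| ≤ C) → Integrable g μ :=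
    fun hg C hC => Integrable.of_bound hg.aestronglyMeasurable C (ae_of_all _ hC)
  have hum : ∀ t, Measurable (u t) := fun t => (hu t).mono (𝓕.le t) le_rfl
  have hξm : ∀ t, Measurable (ξ t) := fun t => (hξ t).mono (𝓕.le _) le_rfl
  have hZm' : ∀ n, Measurable (Z n) := fun n => (hZm n).mono (𝓕.le n) le_rfl
  have hξi : ∀ t, Integrable (ξ t) μ := fun t => hint (hξm t) 1 (hξ1 t)
  have hsucc : ∀ n ω, Z (n + 1) ω = Z n ω + u n ω * ξ n ω := fun n ω =>
    Finset.sum_range_succ _ _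
  have hmart : Martingale Z 𝓕 μ := by
    refine martingale_of_condExp_sub_eq_zero_nat (fun n => (hZm n).stronglyMeasurable)
      (fun n => hint (hZm' n) _ (hZb n)) fun n => ?_
    have : Z (n + 1) - Z n = u n * ξ n := by
      funext ω
      simp [hsucc]
    rw [this]
    have h := condExp_stronglyMeasurable_mul_of_bound (𝓕.le n) (hu n).stronglyMeasurable (hξi n)
      (K + 1) (ae_of_all μ (hub n))
    filter_upwards [h, hξ0 n] with ω h1 h2
    simp [h1, h2]
  -- The cross terms vanish, so the second moments add up.
  have hcross : ∀ n, ∫ ω, Z n ω * u n ω * ξ n ω ∂μ = 0 := by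
    intro n
    have h := condExp_stronglyMeasurable_mul_of_bound (𝓕.le n)
      (f := fun ω => Z n ω * u n ω) ((hZm n).mul (hu n)).stronglyMeasurable (hξi n)
      (n * (K + 1) * (K + 1)) (ae_of_all μ fun ω => by
        rw [norm_mul]
        exact mul_le_mul (hZb n ω) (hub n ω) (abs_nonneg _) (by positivity))
    calc ∫ ω, Z n ω * u n ω * ξ n ω ∂μ
        = ∫ ω, (μ[(fun ω => Z n ω * u n ω) * ξ n | 𝓕 n]) ω ∂μ := (integral_condExp (𝓕.le n)).symm
      _ = ∫ ω, (0 : ℝ) ∂μ := by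
          refine integral_congr_ae ?_
          filter_upwards [h, hξ0 n] with ω h1 h2
          simp [h1, h2]
      _ = 0 := by simp
  have hsq : ∀ n, ∫ ω, Z n ω ^ 2 ∂μ ≤ ∫ ω, ∑ t ∈ Finset.range n, u t ω ^ 2 ∂μ := by
    intro n
    induction n with
    | zero => simp [hZ]
    | succ n ih =>
      have i1 : Integrable (fun ω => Z n ω ^ 2) μ :=
        hint ((hZm' n).pow_const 2) ((n * (K + 1)) ^ 2) fun ω => by
          rw [abs_pow]; exact pow_le_pow_left₀ (abs_nonneg _) (hZb n ω) 2
      have i2 : Integrable (fun ω => Z n ω * u n ω * ξ n ω) μ :=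
        hint (((hZm' n).mul (hum n)).mul (hξm n)) (n * (K + 1) * (K + 1)) fun ω => by
          rw [mul_assoc, abs_mul]
          exact mul_le_mul (hZb n ω) (huξ n ω) (abs_nonneg _) (by positivity)
      have i12 : Integrable (fun ω => Z n ω ^ 2 + 2 * (Z n ω * u n ω * ξ n ω)) μ :=
        i1.add (i2.const_mul 2)
      have i3 : Integrable (fun ω => (u n ω * ξ n ω) ^ 2) μ :=
        hint (((hum n).mul (hξm n)).pow_const 2) ((K + 1) ^ 2) fun ω => by
          rw [abs_pow]; exact pow_le_pow_left₀ (abs_nonneg _) (huξ n ω) 2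
      have i4 : Integrable (fun ω => u n ω ^ 2) μ :=
        hint ((hum n).pow_const 2) ((K + 1) ^ 2) fun ω => by
          rw [abs_pow]; exact pow_le_pow_left₀ (abs_nonneg _) (hub n ω) 2
      have i5 : Integrable (fun ω => ∑ t ∈ Finset.range n, u t ω ^ 2) μ :=
        hint (Finset.measurable_sum _ fun t _ => (hum t).pow_const 2) K fun ω => by
          rw [abs_of_nonneg (Finset.sum_nonneg fun t _ => sq_nonneg _)]; exact huK n ω
      have e1 : ∀ ω, Z (n + 1) ω ^ 2 =
          Z n ω ^ 2 + 2 * (Z n ω * u n ω * ξ n ω) + (u n ω * ξ n ω) ^ 2 := fun ω => by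
        rw [hsucc]; ring
      simp only [e1, Finset.sum_range_succ]
      rw [integral_add i12 i3, integral_add i1 (i2.const_mul 2),
        integral_const_mul, hcross, integral_add i5 i4]
      have h3 : ∫ ω, (u n ω * ξ n ω) ^ 2 ∂μ ≤ ∫ ω, u n ω ^ 2 ∂μ := by
        refine integral_mono i3 i4 fun ω => ?_
        simp only [mul_pow]
        refine mul_le_of_le_one_right (sq_nonneg _) ?_
        rw [← sq_abs]
        exact pow_le_one₀ (abs_nonneg _) (hξ1 n ω)
      linarith
  refine hmart.submartingale.exists_ae_tendsto_of_bdd (R := (1 + K).toNNReal) fun n => ?_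
  rw [eLpNorm_one_eq_lintegral_enorm,
    ← ofReal_integral_norm_eq_lintegral_enorm (hint (hZm' n) _ (hZb n))]
  refine ENNReal.ofReal_le_ofReal ?_
  have i1 : Integrable (fun ω => Z n ω ^ 2) μ :=
    hint ((hZm' n).pow_const 2) ((n * (K + 1)) ^ 2) fun ω => by
      rw [abs_pow]; exact pow_le_pow_left₀ (abs_nonneg _) (hZb n ω) 2
  calc ∫ ω, ‖Z n ω‖ ∂μ ≤ ∫ ω, (1 + Z n ω ^ 2) ∂μ := by
        refine integral_mono (hint (hZm' n) _ (hZb n)).norm ((integrable_const 1).add i1)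
          fun ω => ?_
        simp only [Real.norm_eq_abs]
        nlinarith [sq_abs (Z n ω), sq_nonneg (|Z n ω| - 1), abs_nonneg (Z n ω)]
    _ = 1 + ∫ ω, Z n ω ^ 2 ∂μ := by rw [integral_add (integrable_const 1) i1]; simp
    _ ≤ 1 + ∫ ω, ∑ t ∈ Finset.range n, u t ω ^ 2 ∂μ := by linarith [hsq n]
    _ ≤ 1 + ∫ ω, K ∂μ := by
        gcongr
        · exact hint (Finset.measurable_sum _ fun t _ => (hum t).pow_const 2) K fun ω => by
            rw [abs_of_nonneg (Finset.sum_nonneg fun t _ => sq_nonneg _)]; exact huK n ω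
        · exact integrable_const K
        · exact fun ω => huK n ω
    _ = 1 + K := by simp

/-- Bounded martingale differences, weighted by predictable weights that are almost surely
square-summable, have an almost surely convergent sum. No moment condition on the weights is
needed: the weights are cut off once their square sum exceeds a constant, and almost every path is
left unchanged by the cut-off for some natural number. -/
theorem ae_exists_tendsto_sum (hu : ∀ t, Measurable[𝓕 t] (u t))
    (hξ : ∀ t, Measurable[𝓕 (t + 1)] (ξ t)) (hξ1 : ∀ t ω, |ξ t ω| ≤ 1)
    (hξ0 : ∀ t, μ[ξ t | 𝓕 t] =ᵐ[μ] 0)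
    (hsum : ∀ᵐ ω ∂μ, Summable fun t => u t ω ^ 2) :
    ∀ᵐ ω ∂μ, ∃ l, Tendsto (fun n => ∑ t ∈ Finset.range n, u t ω * ξ t ω) atTop (𝓝 l) := by
  set v : ℕ → ℕ → Ω → ℝ := fun K t ω =>
    if ∑ i ∈ Finset.range (t + 1), u i ω ^ 2 ≤ K then u t ω else 0 with hv
  have hvm : ∀ K t, Measurable[𝓕 t] (v K t) := by
    intro K t
    refine Measurable.ite ?_ (hu t) measurable_const
    refine measurableSet_le (Finset.measurable_sum _ fun i hi => ?_) measurable_const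
    exact ((hu i).mono (𝓕.mono (Finset.mem_range_succ_iff.1 hi)) le_rfl).pow_const 2
  have hvK : ∀ (K n : ℕ) ω, ∑ t ∈ Finset.range n, v K t ω ^ 2 ≤ K := by
    intro K n ω
    induction n with
    | zero => simp
    | succ n ih =>
      rw [Finset.sum_range_succ]
      by_cases h : ∑ i ∈ Finset.range (n + 1), u i ω ^ 2 ≤ K
      · refine le_trans ?_ h
        rw [Finset.sum_range_succ]
        refine add_le_add (Finset.sum_le_sum fun i _ => ?_) ?_
        · simp only [hv]
          split_ifs
          · exact le_rfl
          · simpa using sq_nonneg (u i ω)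
        · simp [hv, h]
      · simpa [hv, h] using ih
  have hconv : ∀ K : ℕ, ∀ᵐ ω ∂μ, ∃ l,
      Tendsto (fun n => ∑ t ∈ Finset.range n, v K t ω * ξ t ω) atTop (𝓝 l) := fun K =>
    ae_exists_tendsto_sum_of_sq_le K.cast_nonneg (hvm K) hξ hξ1 hξ0 (hvK K)
  filter_upwards [ae_all_iff.2 hconv, hsum] with ω h1 h2
  obtain ⟨K, hK⟩ := exists_nat_ge (∑' t, u t ω ^ 2)
  have hvu : ∀ t, v K t ω = u t ω := fun t =>
    if_pos ((h2.sum_le_tsum _ fun i _ => sq_nonneg _).trans hK)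
  simpa only [hvu] using h1 K

end StochApprox

/-! ### The update in regular space -/

/-- Second-order bound for Bernoulli's inequality, with a remainder proportional to the
exponent. -/
lemma abs_one_add_rpow_sub_le {h p : ℝ} (hh : |h| ≤ 1 / 2) (hp0 : 0 ≤ p) (hp1 : p ≤ 1) :
    |(1 + h) ^ p - 1 - p * h| ≤ 2 * p * h ^ 2 := by
  obtain ⟨hl, hu⟩ := abs_le.1 hh
  have hpos : 0 < 1 + h := by linarith
  have h1 : (1 + h) ^ p ≤ 1 + p * h :=
    rpow_one_add_le_one_add_mul_self (by linarith) hp0 hp1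
  have h2 : (1 + h) ^ (1 - p) ≤ 1 + (1 - p) * h :=
    rpow_one_add_le_one_add_mul_self (by linarith) (by linarith) (by linarith)
  have hden : 1 / 2 ≤ 1 + (1 - p) * h := by nlinarith
  -- The lower bound comes from `(1 + h) ^ p = (1 + h) / (1 + h) ^ (1 - p)`.
  have h3 : (1 + h) ^ p * (1 + h) ^ (1 - p) = 1 + h := by
    rw [← Real.rpow_add hpos]; simp
  have h4 : 1 + h ≤ (1 + h) ^ p * (1 + (1 - p) * h) :=
    h3.symm.trans_le (mul_le_mul_of_nonneg_left h2 (Real.rpow_nonneg hpos.le p))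
  have h5 : 0 ≤ p * h ^ 2 := by positivity
  rw [abs_le]
  constructor
  · have h6 : (1 + p * h - 2 * p * h ^ 2) * (1 + (1 - p) * h) ≤
        (1 + h) ^ p * (1 + (1 - p) * h) := by
      refine le_trans ?_ h4
      nlinarith [mul_nonneg h5 (sub_nonneg.2 hden), mul_nonneg hp0 h5]
    have := le_of_mul_le_mul_right h6 (by linarith)
    linarith
  · linarith

namespace LogQ

variable {γ k c d : ℝ}

lemma fInv_add_pos (x : ℝ) : 0 < fInv γ k c d x + γ ^ k := by
  simp [fInv, Real.exp_pos]

/-- Averaging in logarithmic space is a weighted geometric mean in regular space; the parameters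
`c` and `d` drop out. -/
lemma fInv_average (hc : c ≠ 0) (x p V : ℝ) :
    fInv γ k c d (x + p * (f γ k c d V - x)) + γ ^ k =
      Real.exp ((1 - p) * Real.log (fInv γ k c d x + γ ^ k) + p * Real.log (V + γ ^ k)) := by
  simp only [fInv, f, sub_add_cancel, Real.log_exp]
  congr 1
  field_simp
  ring

lemma le_exp_average {m y v p : ℝ} (hm : 0 < m) (hy : m ≤ y) (hv : m ≤ v) (hp0 : 0 ≤ p)
    (hp1 : p ≤ 1) : m ≤ Real.exp ((1 - p) * Real.log y + p * Real.log v) := by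
  rw [← Real.log_le_iff_le_exp hm]
  have h1 := Real.log_le_log hm hy
  have h2 := Real.log_le_log hm hv
  nlinarith

lemma exp_average_le {B y v p : ℝ} (hy0 : 0 < y) (hv0 : 0 < v) (hy : y ≤ B) (hv : v ≤ B)
    (hp0 : 0 ≤ p) (hp1 : p ≤ 1) : Real.exp ((1 - p) * Real.log y + p * Real.log v) ≤ B := by
  rw [← Real.le_log_iff_exp_le (hy0.trans_le hy)]
  have h1 := Real.log_le_log hy0 hy
  have h2 := Real.log_le_log hv0 hv
  nlinarith

/-- To first order in the small step `β`, the geometric averaging moves `y` by `p * β * D`. -/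
lemma abs_exp_average_sub_le {y D β p : ℝ} (hy : 0 < y) (hβ : |β * D / y| ≤ 1 / 2) (hp0 : 0 ≤ p)
    (hp1 : p ≤ 1) :
    |Real.exp ((1 - p) * Real.log y + p * Real.log (y + β * D)) - y - p * (β * D)| ≤
      2 * p * (β * D) ^ 2 / y := by
  set h := β * D / y with hh
  have hD : β * D = y * h := by rw [hh]; field_simp
  have h1 : 0 < 1 + h := by linarith [(abs_le.1 hβ).1]
  have e : Real.exp ((1 - p) * Real.log y + p * Real.log (y + β * D)) = y * (1 + h) ^ p := by
    rw [hD, show y + y * h = y * (1 + h) by ring, Real.log_mul hy.ne' h1.ne',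
      Real.rpow_def_of_pos h1, ← Real.exp_log hy, Real.log_exp, ← Real.exp_add]
    congr 1
    ring
  rw [e, hD, show y * (1 + h) ^ p - y - p * (y * h) = y * ((1 + h) ^ p - 1 - p * h) by ring,
    abs_mul, abs_of_pos hy, show 2 * p * (y * h) ^ 2 / y = y * (2 * p * h ^ 2) by field_simp]
  exact mul_le_mul_of_nonneg_left (abs_one_add_rpow_sub_le hβ hp0 hp1) hy.le

variable {S A : Type*} [DecidableEq S] [DecidableEq A] {βlog βreg : ℕ → ℝ} {s s' : ℕ → S}
  {a b : ℕ → A} {r : ℕ → ℝ} {T : ℕ → S → A → ℝ} {ρ : ℝ}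

/-- Bounds `m` and `B` for the shifted values `f⁻¹ + γ ^ k` that are inherited by the update
targets. -/
structure Bounds (γ k ρ m B : ℝ) : Prop where
  pos : 0 < m
  low : m ≤ γ ^ k
  high : γ ^ k + ρ / (1 - γ) ≤ B

lemma Bounds.target {m B : ℝ} (h : Bounds γ k ρ m B) (hγ0 : 0 < γ) (hγ1 : γ < 1) {r x : ℝ}
    (hr0 : 0 ≤ r) (hr1 : r ≤ ρ) (hx : m ≤ x + γ ^ k ∧ x + γ ^ k ≤ B) :
    m ≤ r + γ * x + γ ^ k ∧ r + γ * x + γ ^ k ≤ B := by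
  have h1 : 0 < 1 - γ := by linarith
  have h2 : (γ ^ k + ρ / (1 - γ)) * (1 - γ) ≤ B * (1 - γ) :=
    mul_le_mul_of_nonneg_right h.high h1.le
  rw [add_mul, div_mul_cancel₀ _ h1.ne'] at h2
  have h3 := mul_le_mul_of_nonneg_right h.low h1.le
  constructor
  · nlinarith [mul_le_mul_of_nonneg_left hx.1 hγ0.le]
  · nlinarith [mul_le_mul_of_nonneg_left hx.2 hγ0.le]

lemma step_bounds (hγ0 : 0 < γ) (hγ1 : γ < 1) (hc : c ≠ 0) {m B p β r : ℝ}
    (h : Bounds γ k ρ m B) (hp0 : 0 ≤ p) (hp1 : p ≤ 1) (hα : 0 ≤ p * β) (hβ : β ≤ 1)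
    (hr0 : 0 ≤ r) (hr1 : r ≤ ρ) {T : S → A → ℝ}
    (hT : ∀ x y, m ≤ fInv γ k c d (T x y) + γ ^ k ∧ fInv γ k c d (T x y) + γ ^ k ≤ B)
    (s s' : S) (a b : A) (x : S) (y : A) :
    m ≤ fInv γ k c d (step γ k c d p β s a r s' b T x y) + γ ^ k ∧
      fInv γ k c d (step γ k c d p β s a r s' b T x y) + γ ^ k ≤ B := by
  simp only [step]
  split_ifs with hxy
  · -- Nothing is known about the sign of `β` when `p = 0`, but then nothing is updated.
    rcases hp0.eq_or_lt with rfl | hp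
    · simpa using hT s a
    have hβ0 : 0 ≤ β := nonneg_of_mul_nonneg_right hα hp
    obtain ⟨h1, h2⟩ := h.target hγ0 hγ1 hr0 hr1 (hT s' b)
    obtain ⟨h3, h4⟩ := hT s a
    rw [fInv_average hc]
    set X := fInv γ k c d (T s a)
    set U := r + γ * fInv γ k c d (T s' b)
    have h5 : X + β * (U - X) + γ ^ k = (1 - β) * (X + γ ^ k) + β * (U + γ ^ k) := by ring
    have h6 : m ≤ X + β * (U - X) + γ ^ k := by rw [h5]; nlinarith
    have h7 : X + β * (U - X) + γ ^ k ≤ B := by rw [h5]; nlinarith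
    exact ⟨le_exp_average h.pos h3 h6 hp0 hp1,
      exp_average_le (h.pos.trans_le h3) (h.pos.trans_le h6) h4 h7 hp0 hp1⟩
  · exact hT x y

/-- Along a path the shifted values stay in a compact subset of `(0, ∞)`: once `β_reg ≤ 1`, every
update is a weighted geometric mean of numbers within the current bounds. -/
lemma exists_bounds [Finite S] [Finite A] (hγ0 : 0 < γ) (hγ1 : γ < 1) (hc : c ≠ 0)
    (hp : ∀ t, 0 ≤ βlog t ∧ βlog t ≤ 1) (hα : ∀ t, 0 ≤ βlog t * βreg t)
    (hβ : Tendsto βreg atTop (𝓝 0)) (hr : ∀ t, 0 ≤ r t ∧ r t ≤ ρ)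
    (hT : ∀ t, T (t + 1) = step γ k c d (βlog t) (βreg t) (s t) (a t) (r t) (s' t) (b t) (T t)) :
    ∃ m B, Bounds γ k ρ m B ∧
      ∀ t x y, m ≤ fInv γ k c d (T t x y) + γ ^ k ∧ fInv γ k c d (T t x y) + γ ^ k ≤ B := by
  obtain ⟨N, hN⟩ := eventually_atTop.1 (hβ.eventually_le_const one_pos)
  -- Up to time `N` the argument of the logarithm may be nonpositive, but the tables are real and
  -- finite in number, so the values `exp ((T - d) / c)` have positive extrema.
  have : Nonempty (Fin (N + 1) × S × A) := ⟨(0, s 0, a 0)⟩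
  let Y : Fin (N + 1) × S × A → ℝ := fun q => fInv γ k c d (T q.1 q.2.1 q.2.2) + γ ^ k
  obtain ⟨q₀, hq₀⟩ := Finite.exists_min Y
  obtain ⟨q₁, hq₁⟩ := Finite.exists_max Y
  have hb : Bounds γ k ρ (min (Y q₀) (γ ^ k)) (max (Y q₁) (γ ^ k + ρ / (1 - γ))) :=
    ⟨lt_min (fInv_add_pos _) (Real.rpow_pos_of_pos hγ0 k), min_le_right _ _, le_max_right _ _⟩
  refine ⟨_, _, hb, fun t => ?_⟩
  have hsmall : ∀ t ≤ N, ∀ x y,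
      min (Y q₀) (γ ^ k) ≤ fInv γ k c d (T t x y) + γ ^ k ∧
        fInv γ k c d (T t x y) + γ ^ k ≤ max (Y q₁) (γ ^ k + ρ / (1 - γ)) := fun t ht x y =>
    ⟨(min_le_left _ _).trans (hq₀ (⟨t, Nat.lt_succ_of_le ht⟩, x, y)),
      (hq₁ (⟨t, Nat.lt_succ_of_le ht⟩, x, y)).trans (le_max_left _ _)⟩
  rcases le_total t N with ht | ht
  · exact hsmall t ht
  · induction t, ht using Nat.le_induction with
    | base => exact hsmall N le_rfl
    | succ t ht ih =>
      intro x y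
      rw [hT]
      exact step_bounds hγ0 hγ1 hc hb (hp t).1 (hp t).2 (hα t) (hN t ht) (hr t).1 (hr t).2 ih
        _ _ _ _ x y

/-- In regular space the update is an ordinary temporal-difference step with step size
`β_log * β_reg`, up to a relative error of order `β_reg`. -/
lemma exists_step_error_le [Finite S] [Finite A] (hγ0 : 0 < γ) (hγ1 : γ < 1) (hc : c ≠ 0)
    (hp : ∀ t, 0 ≤ βlog t ∧ βlog t ≤ 1) (hα : ∀ t, 0 ≤ βlog t * βreg t)
    (hβ : Tendsto βreg atTop (𝓝 0)) (hr : ∀ t, 0 ≤ r t ∧ r t ≤ ρ)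
    (hT : ∀ t, T (t + 1) = step γ k c d (βlog t) (βreg t) (s t) (a t) (r t) (s' t) (b t) (T t)) :
    ∃ C, ∀ᶠ t in atTop,
      |fInv γ k c d (T (t + 1) (s t) (a t)) - fInv γ k c d (T t (s t) (a t)) -
        βlog t * βreg t *
          (r t + γ * fInv γ k c d (T t (s' t) (b t)) - fInv γ k c d (T t (s t) (a t)))| ≤
      βlog t * βreg t * (C * |βreg t|) := by
  obtain ⟨m, B, hb, hY⟩ := exists_bounds hγ0 hγ1 hc hp hα hβ hr hT
  have hm := hb.pos
  refine ⟨2 * B ^ 2 / m, ?_⟩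
  have hsmall : ∀ᶠ t in atTop, |βreg t| * B / m ≤ 1 / 2 := by
    have h : Tendsto (fun t => |βreg t| * B / m) atTop (𝓝 0) := by
      simpa using (hβ.abs.mul_const B).div_const m
    exact h.eventually_le_const (by norm_num)
  filter_upwards [hsmall] with t ht
  rw [hT t]
  simp only [step, and_self, if_true]
  rcases (hp t).1.eq_or_lt with hp0 | hp0
  · simp [← hp0]
  have hβ0 : 0 ≤ βreg t := nonneg_of_mul_nonneg_right (hα t) hp0
  obtain ⟨h1, h2⟩ := hb.target hγ0 hγ1 (hr t).1 (hr t).2 (hY t (s' t) (b t))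
  obtain ⟨h3, h4⟩ := hY t (s t) (a t)
  have havg := fInv_average (γ := γ) (k := k) (d := d) hc (T t (s t) (a t)) (βlog t)
    (fInv γ k c d (T t (s t) (a t)) + βreg t *
      (r t + γ * fInv γ k c d (T t (s' t) (b t)) - fInv γ k c d (T t (s t) (a t))))
  rw [← eq_sub_iff_add_eq] at havg
  rw [havg]
  set X := fInv γ k c d (T t (s t) (a t))
  set U := r t + γ * fInv γ k c d (T t (s' t) (b t))
  have hy : 0 < X + γ ^ k := hm.trans_le h3
  have hD : |U - X| ≤ B := abs_le.2 ⟨by linarith, by linarith⟩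
  have hh : |βreg t * (U - X) / (X + γ ^ k)| ≤ 1 / 2 := by
    refine le_trans ?_ ht
    rw [abs_div, abs_mul, abs_of_pos hy]
    have hB : 0 ≤ B := (abs_nonneg _).trans hD
    gcongr
  have hmain := abs_exp_average_sub_le hy hh (hp t).1 (hp t).2
  rw [show X + βreg t * (U - X) + γ ^ k = X + γ ^ k + βreg t * (U - X) by ring]
  refine le_trans (le_of_eq ?_) (hmain.trans ?_)
  · congr 1
    ring
  · rw [abs_of_nonneg hβ0, mul_pow, ← sq_abs (U - X)]
    calc 2 * βlog t * (βreg t ^ 2 * |U - X| ^ 2) / (X + γ ^ k)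
        ≤ 2 * βlog t * (βreg t ^ 2 * B ^ 2) / m := by gcongr
      _ = βlog t * βreg t * (2 * B ^ 2 / m * βreg t) := by ring

end LogQ

/-! ### Convergence along a path -/

namespace LogQ

variable {S A : Type*} {γ k c d : ℝ}

lemma rPlus_sub_rMinus (r : ℝ) : rPlus r - rMinus r = r := by
  unfold rPlus rMinus
  split_ifs with h1 h2 h2
  · linarith
  · ring
  · rw [abs_of_neg h2]; ring
  · linarith

lemma rPlus_mem {r ρ : ℝ} (h : |r| ≤ ρ) : 0 ≤ rPlus r ∧ rPlus r ≤ ρ := by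
  unfold rPlus
  split_ifs with h1
  · exact ⟨h1, (le_abs_self r).trans h⟩
  · exact ⟨le_rfl, (abs_nonneg r).trans h⟩

lemma rMinus_mem {r ρ : ℝ} (h : |r| ≤ ρ) : 0 ≤ rMinus r ∧ rMinus r ≤ ρ := by
  unfold rMinus
  split_ifs with h1
  · exact ⟨abs_nonneg r, h⟩
  · exact ⟨le_rfl, (abs_nonneg r).trans h⟩

variable [Fintype S] [Fintype A] [DecidableEq S] [DecidableEq A] (M : MDP S A)
  {T₀ : (S → A → ℝ) × (S → A → ℝ)} {βlog βreg : ℕ → ℝ} {s s' : ℕ → S} {a b : ℕ → A}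

lemma exists_abs_Q_le (hγ0 : 0 < γ) (hγ1 : γ < 1) (hc : c ≠ 0)
    (hp : ∀ t, 0 ≤ βlog t ∧ βlog t ≤ 1) (hα : ∀ t, 0 ≤ βlog t * βreg t)
    (hβ : Tendsto βreg atTop (𝓝 0)) :
    ∃ B, ∀ t x y, |Q M γ k c d T₀ βlog βreg s a s' b t x y| ≤ B := by
  obtain ⟨ρ, hρ⟩ := M.exists_abs_reward_le
  obtain ⟨m₁, B₁, -, h₁⟩ := exists_bounds (k := k) (d := d) hγ0 hγ1 hc hp hα hβ
    (r := fun t => rPlus (M.R (s t) (a t) (s' t)))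
    (T := fun t => (tables M γ k c d T₀ βlog βreg s a s' b t).1)
    (fun t => rPlus_mem (hρ _ _ _)) fun t => rfl
  obtain ⟨m₂, B₂, -, h₂⟩ := exists_bounds (k := k) (d := d) hγ0 hγ1 hc hp hα hβ
    (r := fun t => rMinus (M.R (s t) (a t) (s' t)))
    (T := fun t => (tables M γ k c d T₀ βlog βreg s a s' b t).2)
    (fun t => rMinus_mem (hρ _ _ _)) fun t => rfl
  refine ⟨max (B₁ - m₂) (B₂ - m₁), fun t x y => ?_⟩
  have hb₁ := h₁ t x y
  have hb₂ := h₂ t x y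
  simp only [Q, combine]
  rw [abs_le]
  constructor
  · linarith [le_max_right (B₁ - m₂) (B₂ - m₁)]
  · linarith [le_max_left (B₁ - m₂) (B₂ - m₁)]

/-- The difference of the two tables in regular space follows ordinary Q-learning, up to a relative
error of order `β_reg`: the first-order terms of the two updates subtract, and
`r⁺ - r⁻ = r`. -/
lemma exists_Q_step_error_le (hγ0 : 0 < γ) (hγ1 : γ < 1) (hc : c ≠ 0)
    (hp : ∀ t, 0 ≤ βlog t ∧ βlog t ≤ 1) (hα : ∀ t, 0 ≤ βlog t * βreg t)
    (hβ : Tendsto βreg atTop (𝓝 0)) :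
    ∃ C, ∀ᶠ t in atTop, ∀ x y,
      |Q M γ k c d T₀ βlog βreg s a s' b (t + 1) x y - Q M γ k c d T₀ βlog βreg s a s' b t x y -
        (if s t = x ∧ a t = y then βlog t * βreg t else 0) *
          (M.R (s t) (a t) (s' t) + γ * Q M γ k c d T₀ βlog βreg s a s' b t (s' t) (b t) -
            Q M γ k c d T₀ βlog βreg s a s' b t x y)| ≤
      (if s t = x ∧ a t = y then βlog t * βreg t else 0) * (C * |βreg t|) := by
  obtain ⟨ρ, hρ⟩ := M.exists_abs_reward_le
  obtain ⟨C₁, h₁⟩ := exists_step_error_le (k := k) (d := d) hγ0 hγ1 hc hp hα hβ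
    (r := fun t => rPlus (M.R (s t) (a t) (s' t)))
    (T := fun t => (tables M γ k c d T₀ βlog βreg s a s' b t).1)
    (fun t => rPlus_mem (hρ _ _ _)) fun t => rfl
  obtain ⟨C₂, h₂⟩ := exists_step_error_le (k := k) (d := d) hγ0 hγ1 hc hp hα hβ
    (r := fun t => rMinus (M.R (s t) (a t) (s' t)))
    (T := fun t => (tables M γ k c d T₀ βlog βreg s a s' b t).2)
    (fun t => rMinus_mem (hρ _ _ _)) fun t => rfl
  refine ⟨C₁ + C₂, ?_⟩
  filter_upwards [h₁, h₂] with t e₁ e₂ x y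
  split_ifs with hxy
  · obtain ⟨rfl, rfl⟩ := hxy
    simp only [Q, combine]
    have hr := rPlus_sub_rMinus (M.R (s t) (a t) (s' t))
    set V := tables M γ k c d T₀ βlog βreg s a s' b t
    set V' := tables M γ k c d T₀ βlog βreg s a s' b (t + 1)
    rw [add_mul, mul_add]
    refine le_trans (le_of_eq ?_) ((abs_sub _ _).trans (add_le_add e₁ e₂))
    congr 1
    linear_combination βlog t * βreg t * hr
  · have hxy' : ¬(x = s t ∧ y = a t) := fun h => hxy ⟨h.1.symm, h.2.symm⟩
    simp [Q, combine, tables, step, hxy']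

/-- The deterministic half of the convergence theorem: on a path along which the weighted noise of
the sampled Bellman targets has a convergent sum for each state-action pair, `Q_t` converges to `Q*`. -/
lemma tendsto_Q_of_noise [Nonempty A] (hγ0 : 0 < γ) (hγ1 : γ < 1) (hc : c ≠ 0)
    (hp : ∀ t, 0 ≤ βlog t ∧ βlog t ≤ 1)
    (hα : ∀ t, 0 ≤ βlog t * βreg t ∧ βlog t * βreg t ≤ 1)
    (hsum : ∀ x y, Tendsto (fun n => ∑ t ∈ Finset.range n,
      if s t = x ∧ a t = y then βlog t * βreg t else 0) atTop atTop)
    (hβ : Tendsto βreg atTop (𝓝 0))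
    (hmax : ∀ t a', Q M γ k c d T₀ βlog βreg s a s' b t (s' t) a' ≤
      Q M γ k c d T₀ βlog βreg s a s' b t (s' t) (b t))
    (hnoise : ∀ x y, ∃ l, Tendsto (fun n => ∑ t ∈ Finset.range n,
      (if s t = x ∧ a t = y then βlog t * βreg t else 0) *
        (M.R (s t) (a t) (s' t) + γ * (⨆ y', Q M γ k c d T₀ βlog βreg s a s' b t (s' t) y') -
          M.bellman γ (fun i => Q M γ k c d T₀ βlog βreg s a s' b t i.1 i.2) (s t, a t)))
      atTop (𝓝 l)) (x : S) (y : A) :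
    Tendsto (fun t => Q M γ k c d T₀ βlog βreg s a s' b t x y) atTop (𝓝 (M.qStar γ x y)) := by
  obtain ⟨C, hC⟩ := exists_Q_step_error_le (k := k) (d := d) (T₀ := T₀) (s := s) (s' := s')
    (a := a) (b := b) M hγ0 hγ1 hc hp (fun t => (hα t).1) hβ
  obtain ⟨B, hB⟩ := exists_abs_Q_le (k := k) (d := d) (T₀ := T₀) (s := s) (s' := s')
    (a := a) (b := b) M hγ0 hγ1 hc hp (fun t => (hα t).1) hβ
  have hsup : ∀ t, (⨆ y', Q M γ k c d T₀ βlog βreg s a s' b t (s' t) y') =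
      Q M γ k c d T₀ βlog βreg s a s' b t (s' t) (b t) := fun t =>
    le_antisymm (ciSup_le (hmax t))
      (le_ciSup (f := fun y' => Q M γ k c d T₀ βlog βreg s a s' b t (s' t) y')
        (Set.finite_range _).bddAbove (b t))
  have hstar := M.bellman_qStar hγ0.le hγ1
  simp only [hsup] at hnoise
  set q : ℕ → S × A → ℝ := fun t i => Q M γ k c d T₀ βlog βreg s a s' b t i.1 i.2 with hq
  set qs : S × A → ℝ := fun i => M.qStar γ i.1 i.2 with hqs
  set α : S × A → ℕ → ℝ := fun i t => if s t = i.1 ∧ a t = i.2 then βlog t * βreg t else 0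
    with hαdef
  set w : ℕ → ℝ := fun t => M.R (s t) (a t) (s' t) + γ * q t (s' t, b t) -
    M.bellman γ (q t) (s t, a t) with hw
  have hα0 : ∀ i t, 0 ≤ α i t := by
    intro i t
    simp only [hαdef]
    split_ifs
    exacts [(hα t).1, le_rfl]
  have hα1 : ∀ i t, α i t ≤ 1 := by
    intro i t
    simp only [hαdef]
    split_ifs
    exacts [(hα t).2, zero_le_one]
  have hαsum : ∀ i, Tendsto (fun n => ∑ t ∈ Finset.range n, α i t) atTop atTop :=
    fun i => hsum i.1 i.2
  have hWex : ∀ i, ∃ W : ℕ → ℝ, Tendsto W atTop (𝓝 0) ∧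
      ∀ t, W (t + 1) = (1 - α i t) * W t + α i t * w t := fun i =>
    StochApprox.exists_averagedNoise (hα0 i) (hα1 i) (hαsum i) (hnoise i.1 i.2).choose_spec
  choose W hW0 hW using hWex
  have hWlim : Tendsto (fun t i => W i t) atTop (𝓝 (0 : S × A → ℝ)) :=
    tendsto_pi_nhds.2 hW0
  -- The error with the averaged noise removed is contracted.
  set Δ : ℕ → S × A → ℝ := fun t i => q t i - qs i - W i t with hΔ
  obtain ⟨BW, hBW⟩ := hWlim.norm.bddAbove_range
  have hΔB : ∀ t, ‖Δ t‖ ≤ |B| + ‖qs‖ + BW := by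
    intro t
    have h1 : ‖q t‖ ≤ |B| := (pi_norm_le_iff_of_nonneg (abs_nonneg B)).2 fun i =>
      (hB t i.1 i.2).trans (le_abs_self B)
    have h2 : ‖fun i => W i t‖ ≤ BW := hBW ⟨t, rfl⟩
    have h3 : Δ t = q t - qs - fun i => W i t := rfl
    rw [h3]
    exact (norm_sub_le _ _).trans (add_le_add ((norm_sub_le _ _).trans (by gcongr)) h2)
  have hη : Tendsto (fun t => γ * ‖fun i => W i t‖ + C * |βreg t|) atTop (𝓝 0) := by
    simpa using (hWlim.norm.const_mul γ).add (hβ.abs.const_mul C)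
  have hΔ0 : Tendsto Δ atTop (𝓝 0) := by
    refine StochApprox.tendsto_zero_of_contraction hγ0 hγ1 hα0 hα1 hαsum hΔB hη ?_
    filter_upwards [hC] with t ht i
    have herr := ht i.1 i.2
    change |q (t + 1) i - q t i - α i t * (M.R (s t) (a t) (s' t) + γ * q t (s' t, b t) - q t i)|
      ≤ α i t * (C * |βreg t|) at herr
    have hbell : α i t * (M.R (s t) (a t) (s' t) + γ * q t (s' t, b t)) =
        α i t * (M.bellman γ (q t) i + w t) := by
      by_cases hi : s t = i.1 ∧ a t = i.2
      · have hi' : (s t, a t) = i := Prod.ext hi.1 hi.2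
        rw [hw]
        simp only [hi']
        ring
      · simp [hαdef, hi]
    have hcontr : |M.bellman γ (q t) i - qs i| ≤ γ * (‖Δ t‖ + ‖fun i => W i t‖) := by
      have h1 := M.abs_bellman_sub_le hγ0.le (q t) qs i
      rw [hstar] at h1
      refine h1.trans (mul_le_mul_of_nonneg_left ?_ hγ0.le)
      have h2 : q t - qs = Δ t + fun i => W i t := by
        funext j
        simp [hΔ]
      rw [h2]
      exact norm_add_le _ _
    have hdecomp : Δ (t + 1) i = (1 - α i t) * Δ t i + α i t * (M.bellman γ (q t) i - qs i) +
        (q (t + 1) i - q t i -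
          α i t * (M.R (s t) (a t) (s' t) + γ * q t (s' t, b t) - q t i)) := by
      rw [mul_sub (α i t) (_ + _), hbell]
      simp only [hΔ, hW]
      ring
    rw [hdecomp]
    refine (abs_add_le _ _).trans ?_
    refine (add_le_add (abs_add_le _ _) herr).trans ?_
    rw [abs_mul, abs_mul, abs_of_nonneg (hα0 i t), abs_of_nonneg (sub_nonneg.2 (hα1 i t))]
    have := mul_le_mul_of_nonneg_left hcontr (hα0 i t)
    nlinarith
  have hlim := (hΔ0.add hWlim).add_const qs
  have hqlim : (fun t => Δ t + (fun i => W i t) + qs) = q := by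
    funext t i
    simp [hΔ]
  rw [hqlim, zero_add, zero_add] at hlim
  exact tendsto_pi_nhds.1 hlim (x, y)

end LogQ

/-! ### Measurability of the tables -/

lemma measurable_apply_of_countable {Ω ι : Type*} [MeasurableSpace Ω] [Countable ι]
    [MeasurableSpace ι] [MeasurableSingletonClass ι] {F : Ω → ι → ℝ}
    (hF : ∀ i, Measurable fun ω => F ω i) {g : Ω → ι} (hg : Measurable g) :
    Measurable fun ω => F ω (g ω) :=
  (measurable_from_prod_countable_right (f := fun p : ι × Ω => F p.2 p.1) hF).comp
    (hg.prodMk measurable_id)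

namespace LogQ

variable {S A : Type*} {γ k c d : ℝ} [MeasurableSpace S] [MeasurableSingletonClass S]
  [MeasurableSpace A] [MeasurableSingletonClass A] {Ω : Type*}

lemma measurable_f : Measurable (f γ k c d) := by
  unfold f
  fun_prop

lemma measurable_fInv : Measurable (fInv γ k c d) := by
  unfold fInv
  fun_prop

lemma measurable_step [Countable S] [Countable A] [DecidableEq S] [DecidableEq A]
    {m : MeasurableSpace Ω} {p β r : Ω → ℝ} {s s' : Ω → S} {a b : Ω → A} {T : Ω → S → A → ℝ}
    (hp : Measurable p) (hβ : Measurable β) (hr : Measurable r) (hs : Measurable s)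
    (ha : Measurable a) (hs' : Measurable s') (hb : Measurable b)
    (hT : ∀ x y, Measurable fun ω => T ω x y) (x : S) (y : A) :
    Measurable fun ω => step γ k c d (p ω) (β ω) (s ω) (a ω) (r ω) (s' ω) (b ω) (T ω) x y := by
  have h1 : Measurable fun ω => T ω (s ω) (a ω) :=
    measurable_apply_of_countable (F := fun ω (i : S × A) => T ω i.1 i.2)
      (fun i => hT i.1 i.2) (hs.prodMk ha)
  have h2 : Measurable fun ω => T ω (s' ω) (b ω) :=
    measurable_apply_of_countable (F := fun ω (i : S × A) => T ω i.1 i.2)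
      (fun i => hT i.1 i.2) (hs'.prodMk hb)
  have h3 := measurable_fInv (γ := γ) (k := k) (c := c) (d := d) |>.comp h1
  have h4 := measurable_fInv (γ := γ) (k := k) (c := c) (d := d) |>.comp h2
  refine Measurable.ite ?_ (h1.add (hp.mul (Measurable.sub (measurable_f.comp
    (h3.add (hβ.mul ((hr.add (h4.const_mul γ)).sub h3)))) h1))) (hT x y)
  exact (measurableSet_eq_fun measurable_const hs).inter (measurableSet_eq_fun measurable_const ha)

lemma measurable_tables [Countable S] [Countable A] [DecidableEq S] [DecidableEq A]
    {mΩ : MeasurableSpace Ω} {𝓕 : Filtration ℕ mΩ} (M : MDP S A)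
    {T₀ : (S → A → ℝ) × (S → A → ℝ)} {βlog βreg : ℕ → Ω → ℝ} {s s' : ℕ → Ω → S} {a b : ℕ → Ω → A}
    (hβlog : ∀ t, Measurable[𝓕 t] (βlog t)) (hβreg : ∀ t, Measurable[𝓕 t] (βreg t))
    (hs : ∀ t, Measurable[𝓕 t] (s t)) (ha : ∀ t, Measurable[𝓕 t] (a t))
    (hs' : ∀ t, Measurable[𝓕 (t + 1)] (s' t)) (hb : ∀ t, Measurable[𝓕 (t + 1)] (b t)) (t : ℕ) :
    (∀ x y, Measurable[𝓕 t] fun ω =>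
      (tables M γ k c d T₀ (βlog · ω) (βreg · ω) (s · ω) (a · ω) (s' · ω) (b · ω) t).1 x y) ∧
    (∀ x y, Measurable[𝓕 t] fun ω =>
      (tables M γ k c d T₀ (βlog · ω) (βreg · ω) (s · ω) (a · ω) (s' · ω) (b · ω) t).2 x y) := by
  induction t with
  | zero =>
    exact ⟨fun x y => measurable_const (a := T₀.1 x y),
      fun x y => measurable_const (a := T₀.2 x y)⟩
  | succ t ih =>
    have hle : 𝓕 t ≤ 𝓕 (t + 1) := 𝓕.mono t.le_succ
    have hR : Measurable[𝓕 (t + 1)] fun ω => M.R (s t ω) (a t ω) (s' t ω) :=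
      (measurable_of_countable fun i : S × A × S => M.R i.1 i.2.1 i.2.2).comp
        (((hs t).mono hle le_rfl).prodMk (((ha t).mono hle le_rfl).prodMk (hs' t)))
    have hplus : Measurable rPlus :=
      Measurable.ite (measurableSet_le measurable_const measurable_id) measurable_id
        measurable_const
    have hminus : Measurable rMinus :=
      Measurable.ite (measurableSet_lt measurable_id measurable_const) measurable_id.abs
        measurable_const
    exact ⟨measurable_step (m := 𝓕 (t + 1)) ((hβlog t).mono hle le_rfl) ((hβreg t).mono hle le_rfl)
        (hplus.comp hR) ((hs t).mono hle le_rfl) ((ha t).mono hle le_rfl) (hs' t) (hb t)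
        fun x y => (ih.1 x y).mono hle le_rfl,
      measurable_step (m := 𝓕 (t + 1)) ((hβlog t).mono hle le_rfl) ((hβreg t).mono hle le_rfl)
        (hminus.comp hR) ((hs t).mono hle le_rfl) ((ha t).mono hle le_rfl) (hs' t) (hb t)
        fun x y => (ih.2 x y).mono hle le_rfl⟩

end LogQ

/-! ### The noise of the sampled transitions -/

namespace MDP

variable {S A : Type*} {M : MDP S A} {Ω : Type*} {s : ℕ → Ω → S} {a : ℕ → Ω → A} {s' : ℕ → Ω → S}

/-- The indicator of the next state `z`, centred at its conditional probability. -/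
noncomputable def transitionNoise (M : MDP S A) (s : ℕ → Ω → S) (a : ℕ → Ω → A) (s' : ℕ → Ω → S)
    (z : S) (t : ℕ) (ω : Ω) : ℝ :=
  (s' t ⁻¹' {z}).indicator (fun _ => (1 : ℝ)) ω - (M.P (s t ω) (a t ω) z).toReal

lemma abs_transitionNoise_le (z : S) (t : ℕ) (ω : Ω) : |M.transitionNoise s a s' z t ω| ≤ 1 := by
  have h1 : (M.P (s t ω) (a t ω) z).toReal ≤ 1 :=
    ENNReal.toReal_le_of_le_ofReal zero_le_one (by simpa using PMF.coe_le_one _ z)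
  have h0 : 0 ≤ (M.P (s t ω) (a t ω) z).toReal := ENNReal.toReal_nonneg
  unfold transitionNoise Set.indicator
  rw [abs_le]
  split_ifs <;> constructor <;> linarith

/-- The deviation of a sampled value from its conditional mean is a combination of the
martingale differences of the transitions. -/
lemma sub_sum_eq_sum_transitionNoise [Fintype S] (g : S → ℝ) (t : ℕ) (ω : Ω) :
    g (s' t ω) - ∑ z, (M.P (s t ω) (a t ω) z).toReal * g z =
      ∑ z, g z * M.transitionNoise s a s' z t ω := by
  classical
  have h1 : g (s' t ω) = ∑ z, g z * (s' t ⁻¹' {z}).indicator (fun _ => (1 : ℝ)) ω := by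
    rw [Finset.sum_eq_single (s' t ω)]
    · simp
    · intro z _ hz
      simp [Set.indicator, hz.symm]
    · simp
  rw [h1, ← Finset.sum_sub_distrib]
  refine Finset.sum_congr rfl fun z _ => ?_
  unfold transitionNoise
  ring

namespace IsExperience

variable [MeasurableSpace S] [MeasurableSingletonClass S] [MeasurableSpace A]
  [MeasurableSingletonClass A] [Countable S] [Countable A] {mΩ : MeasurableSpace Ω}
  {μ : Measure Ω} {𝓕 : Filtration ℕ mΩ}

lemma measurable_prob (h : M.IsExperience μ 𝓕 s a s') (z : S) (t : ℕ) :
    Measurable[𝓕 t] fun ω => (M.P (s t ω) (a t ω) z).toReal :=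
  (measurable_of_countable fun i : S × A => (M.P i.1 i.2 z).toReal).comp
    ((h.measurable_state t).prodMk (h.measurable_action t))

lemma measurable_transitionNoise (h : M.IsExperience μ 𝓕 s a s') (z : S) (t : ℕ) :
    Measurable[𝓕 (t + 1)] (M.transitionNoise s a s' z t) :=
  (measurable_const.indicator (h.measurable_next t (measurableSet_singleton z))).sub
    ((h.measurable_prob z t).mono (𝓕.mono t.le_succ) le_rfl)

lemma condExp_transitionNoise (h : M.IsExperience μ 𝓕 s a s') [IsFiniteMeasure μ]
    (z : S) (t : ℕ) :
    μ[M.transitionNoise s a s' z t | 𝓕 t] =ᵐ[μ] 0 := by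
  have hP := h.measurable_prob z t
  have hPi : Integrable (fun ω => (M.P (s t ω) (a t ω) z).toReal) μ :=
    Integrable.of_bound (hP.mono (𝓕.le t) le_rfl).aestronglyMeasurable 1 <| ae_of_all _ fun ω => by
      rw [Real.norm_of_nonneg ENNReal.toReal_nonneg]
      exact ENNReal.toReal_le_of_le_ofReal zero_le_one (by simpa using PMF.coe_le_one _ z)
  have hIi : Integrable ((s' t ⁻¹' {z}).indicator fun _ => (1 : ℝ)) μ :=
    (integrable_const 1).indicator
      (𝓕.le (t + 1) _ (h.measurable_next t (measurableSet_singleton z)))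
  have hsub := condExp_sub hIi hPi (𝓕 t)
  rw [condExp_of_stronglyMeasurable (𝓕.le t) hP.stronglyMeasurable hPi] at hsub
  filter_upwards [hsub, h.transition t z] with ω h1 h2
  have h3 : M.transitionNoise s a s' z t =
      ((s' t ⁻¹' {z}).indicator fun _ => (1 : ℝ)) - fun ω => (M.P (s t ω) (a t ω) z).toReal := rfl
  rw [h3, h1, Pi.sub_apply, h2, sub_self, Pi.zero_apply]

end IsExperience

end MDP

/-! ### Convergence of logarithmic Q-learning -/

theorem mainTheorem1 {S A : Type*} [Fintype S] [Fintype A] [DecidableEq S] [DecidableEq A]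
    [MeasurableSpace S] [MeasurableSingletonClass S]
    [MeasurableSpace A] [MeasurableSingletonClass A]
    (M : MDP S A)
    (γ k c d : ℝ) (hγ0 : 0 < γ) (hγ1 : γ < 1) (hc : c ≠ 0)
    {Ω : Type*} {mΩ : MeasurableSpace Ω} (μ : Measure Ω) [IsProbabilityMeasure μ]
    (𝓕 : Filtration ℕ mΩ)
    (s : ℕ → Ω → S) (a : ℕ → Ω → A) (s' : ℕ → Ω → S)
    (hexp : M.IsExperience μ 𝓕 s a s')
    (T₀ : (S → A → ℝ) × (S → A → ℝ))
    (βlog βreg : ℕ → Ω → ℝ)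
    (hβlog : ∀ t, Measurable[𝓕 t] (βlog t)) (hβreg : ∀ t, Measurable[𝓕 t] (βreg t))
    (b : ℕ → Ω → A) (hb : ∀ t, Measurable[𝓕 (t + 1)] (b t))
    -- `b t` is a maximizer of `Q_t(s' t, ·)`, with ties broken in any way
    (hbmax : ∀ᵐ ω ∂μ, ∀ t a',
      LogQ.Q M γ k c d T₀ (βlog · ω) (βreg · ω) (s · ω) (a · ω) (s' · ω) (b · ω) t (s' t ω) a' ≤
      LogQ.Q M γ k c d T₀ (βlog · ω) (βreg · ω) (s · ω) (a · ω) (s' · ω) (b · ω) t (s' t ω) (b t ω))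
    (hlog : ∀ᵐ ω ∂μ, ∀ t, 0 ≤ βlog t ω ∧ βlog t ω ≤ 1)
    (h1 : ∀ᵐ ω ∂μ, ∀ t, 0 ≤ βlog t ω * βreg t ω ∧ βlog t ω * βreg t ω ≤ 1)
    -- the step-sizes used at each state-action pair have infinite sum
    (h2 : ∀ᵐ ω ∂μ, ∀ x y, Tendsto (fun n => ∑ t ∈ Finset.range n,
      if s t ω = x ∧ a t ω = y then βlog t ω * βreg t ω else 0) atTop atTop)
    (h3 : ∀ᵐ ω ∂μ, Summable fun t => (βlog t ω * βreg t ω) ^ 2)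
    (h4 : ∀ᵐ ω ∂μ, Tendsto (fun t => βreg t ω) atTop (𝓝 0)) :
    ∀ᵐ ω ∂μ, ∀ x y, Tendsto
      (fun t => LogQ.Q M γ k c d T₀ (βlog · ω) (βreg · ω) (s · ω) (a · ω) (s' · ω) (b · ω) t x y)
      atTop (𝓝 (M.qStar γ x y)) := by
  rcases isEmpty_or_nonempty A with hA | hA
  · exact ae_of_all μ fun ω x y => hA.elim y
  have htab := LogQ.measurable_tables (γ := γ) (k := k) (c := c) (d := d) (T₀ := T₀) M hβlog hβreg
    hexp.measurable_state hexp.measurable_action hexp.measurable_next hb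
  set q : ℕ → Ω → S → A → ℝ := fun t ω =>
    LogQ.Q M γ k c d T₀ (βlog · ω) (βreg · ω) (s · ω) (a · ω) (s' · ω) (b · ω) t with hq
  have hqm : ∀ t x y, Measurable[𝓕 t] fun ω => q t ω x y := fun t x y =>
    (LogQ.measurable_fInv.comp ((htab t).1 x y)).sub (LogQ.measurable_fInv.comp ((htab t).2 x y))
  -- `g z t` is the target that the next state `z` would produce.
  set g : S → ℕ → Ω → ℝ := fun z t ω => M.R (s t ω) (a t ω) z + γ * ⨆ y', q t ω z y' with hg
  have hgm : ∀ z t, Measurable[𝓕 t] (g z t) := fun z t =>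
    ((measurable_of_countable fun i : S × A => M.R i.1 i.2 z).comp
      ((hexp.measurable_state t).prodMk (hexp.measurable_action t))).add
      ((Measurable.iSup fun y' => hqm t z y').const_mul γ)
  set α : S → A → ℕ → Ω → ℝ := fun x y t ω =>
    if s t ω = x ∧ a t ω = y then βlog t ω * βreg t ω else 0 with hα
  have hαm : ∀ x y t, Measurable[𝓕 t] (α x y t) := fun x y t =>
    Measurable.ite ((hexp.measurable_state t (measurableSet_singleton x)).inter
      (hexp.measurable_action t (measurableSet_singleton y)))
      ((hβlog t).mul (hβreg t)) measurable_const
  have hnoise : ∀ x y z, ∀ᵐ ω ∂μ, ∃ l, Tendsto (fun n => ∑ t ∈ Finset.range n,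
      α x y t ω * g z t ω * M.transitionNoise s a s' z t ω) atTop (𝓝 l) := by
    intro x y z
    refine StochApprox.ae_exists_tendsto_sum (u := fun t ω => α x y t ω * g z t ω)
      (fun t => (hαm x y t).mul (hgm z t)) (hexp.measurable_transitionNoise z)
      (MDP.abs_transitionNoise_le z) (hexp.condExp_transitionNoise z) ?_
    filter_upwards [hlog, h1, h3, h4] with ω l1 l2 l3 l4
    obtain ⟨B, hB⟩ := LogQ.exists_abs_Q_le (k := k) (d := d) (T₀ := T₀) (s := (s · ω))
      (s' := (s' · ω)) (a := (a · ω)) (b := (b · ω)) M hγ0 hγ1 hc l1 (fun t => (l2 t).1) l4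
    obtain ⟨ρ, hρ⟩ := M.exists_abs_reward_le
    have hgB : ∀ t, |g z t ω| ≤ ρ + γ * B := by
      intro t
      refine (abs_add_le _ _).trans (add_le_add (hρ _ _ _) ?_)
      rw [abs_mul, abs_of_pos hγ0]
      refine mul_le_mul_of_nonneg_left ?_ hγ0.le
      obtain ⟨y', hy'⟩ := exists_eq_ciSup_of_finite (f := fun y' => q t ω z y')
      rw [← hy']
      exact hB t z y'
    refine Summable.of_nonneg_of_le (fun t => sq_nonneg _) (fun t => ?_)
      (l3.mul_right ((ρ + γ * B) ^ 2))
    rw [mul_pow]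
    refine mul_le_mul ?_ (sq_le_sq' (abs_le.1 (hgB t)).1 (abs_le.1 (hgB t)).2) (sq_nonneg _)
      (sq_nonneg _)
    simp only [hα]
    split_ifs
    · exact le_rfl
    · simpa using sq_nonneg (βlog t ω * βreg t ω)
  have hnoise' := ae_all_iff.2 fun x => ae_all_iff.2 fun y => ae_all_iff.2 (hnoise x y)
  filter_upwards [hbmax, hlog, h1, h2, h4, hnoise'] with ω l1 l2 l3 l4 l5 l6 x y
  refine LogQ.tendsto_Q_of_noise M hγ0 hγ1 hc l2 l3 l4 l5 l1 (fun x y => ?_) x y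
  choose l hl using l6 x y
  refine ⟨∑ z, l z, (tendsto_finsetSum _ fun z _ => hl z).congr fun n => ?_⟩
  rw [Finset.sum_comm]
  refine Finset.sum_congr rfl fun t _ => ?_
  simp only [mul_assoc]
  rw [← Finset.mul_sum, ← MDP.sub_sum_eq_sum_transitionNoise (fun z => g z t ω)]
  rfl
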